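/- Let $A\in\mathbb{R}^{m\times d}$ be a matrix whose rows are the (real) Fourier coefficient vectors of $m$ time series; $A$ may be any real $m\times d$ matrix. Let $A=\sum_{i=1}^{r}\sigma_i u_i v_i^{\top}$ be a singular value decomposition with $\sigma_1\ge\dots\ge\sigma_r>0$ and orthonormal systems $(u_i)$, $(v_i)$. For $k\in\mathbb{N}$ put $A_k=\sum_{i\le \min(k,r)}\sigma_i u_i v_i^{\top}$, and let $$\mu(A)=\max_{1\le j\le d}\ \sum_{i\le \min(k,r)} (v_i)_j^2$$ be the (rank-$k$) coherence of $A$, i.e. the largest squared row norm of the matrix of its first $k$ right singular vectors. Choose indices $i_1<\dots<i_s$ from $\{1,\dots,d\}$ uniformly at random among all $s$-element subsets ($s\le d$), let $S\in\{0,1\}^{s\times d}$ have entries $S_{j,l}=1$ if $l=i_j$ and $0$ otherwise, and put $A'=AS^{\top}\in\mathbb{R}^{m\times s}$, the matrix of the chosen columns of $A$. Let $P_{A'}(A)$ be the matrix obtained from $A$ by projecting each of its columns orthogonally onto the span of the columns of $A'$, and let $|\cdot|$ be the Frobenius norm. There is an absolute constant $c>0$ such that, for all $m,d,k,s\in\mathbb{N}$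 with $s\le d$, all $A$ (and every singular value decomposition of it), all $C>0$ and all $0<\varepsilon\le 1$: if $$\mu(A)\le C\,\frac{k}{d}\qquad\text{and}\qquad s\ \ge\ c\,C\,\frac{k^2}{\varepsilon^2},$$ then, with probability at least $0.7$ over the choice of the columns, $$|A-P_{A'}(A)|\ \le\ (1+\varepsilon)\,|A-A_k| .$$ -/

import Mathlib

open scoped Matrix.Norms.Frobenius

/-- A (compact) singular value decomposition `A = ∑ i, σ i • u i (v i)ᵀ` of a real matrix:
the singular values are positive and listed in decreasing order, and the left and the right
singular vectors are orthonormal. -/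
structure MatrixSVD {m d : ℕ} (A : Matrix (Fin m) (Fin d) ℝ) where
  /-- the number of nonzero singular values -/
  r : ℕ
  /-- the singular values -/
  σ : Fin r → ℝ
  /-- the left singular vectors -/
  u : Fin r → EuclideanSpace ℝ (Fin m)
  /-- the right singular vectors -/
  v : Fin r → EuclideanSpace ℝ (Fin d)
  σ_pos : ∀ i, 0 < σ i
  σ_antitone : Antitone σ
  u_orthonormal : Orthonormal ℝ u
  v_orthonormal : Orthonormal ℝ v
  eq_sum : A = ∑ i, σ i • Matrix.vecMulVec (u i).ofLp (v i).ofLp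

namespace MatrixSVD

variable {m d : ℕ} {A : Matrix (Fin m) (Fin d) ℝ}

/-- The truncation `A_k` of the decomposition to its `k` largest singular values
(all of them if there are fewer than `k`). -/
noncomputable def trunc (D : MatrixSVD A) (k : ℕ) : Matrix (Fin m) (Fin d) ℝ :=
  ∑ i with i.val < k, D.σ i • Matrix.vecMulVec (D.u i).ofLp (D.v i).ofLp

/-- The leverage score of column `j` relative to the span of the first `k` right singular
vectors, that is, the squared length of row `j` of the matrix `V_k` with these columns. -/
noncomputable def leverage (D : MatrixSVD A) (k : ℕ) (j : Fin d) : ℝ :=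
  ∑ i with i.val < k, (D.v i j) ^ 2

/-- The (rank-`k`) coherence `μ(A)`: the largest of the leverage scores of the columns. -/
noncomputable def coherence (D : MatrixSVD A) (k : ℕ) : ℝ :=
  ⨆ j : Fin d, D.leverage k j

end MatrixSVD

/-- The sets of `s` out of `d` column indices. -/
abbrev ColumnChoice (d s : ℕ) : Type := {I : Finset (Fin d) // I.card = s}

/-- The `0`-`1` selection matrix `S` of the chosen indices `i_1 < ... < i_s`: row `j` has its
only `1` in column `i_j`. -/
def selectionMatrix {d s : ℕ} (I : ColumnChoice d s) : Matrix (Fin s) (Fin d) ℝ :=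
  Matrix.of fun j l => if l = I.1.orderEmbOfFin I.2 j then 1 else 0

/-- The probability of an event when `s` of `d` column indices are chosen uniformly at random
(without repetition). -/
noncomputable def uniformProb {d s : ℕ} (event : Set (ColumnChoice d s)) : ℝ :=
  (event.ncard : ℝ) / (Nat.card (ColumnChoice d s) : ℝ)

/-- The span of the columns of a matrix. -/
def columnSpan {m s : ℕ} (B : Matrix (Fin m) (Fin s) ℝ) :
    Submodule ℝ (EuclideanSpace ℝ (Fin m)) :=
  Submodule.span ℝ (Set.range fun j : Fin s => WithLp.toLp 2 (B.col j))

/-- `P_B(A)`: each column of `A` is projected orthogonally onto the column span of `B`. -/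
noncomputable def projectColumns {m d s : ℕ} (B : Matrix (Fin m) (Fin s) ℝ)
    (A : Matrix (Fin m) (Fin d) ℝ) : Matrix (Fin m) (Fin d) ℝ :=
  Matrix.of fun i j => (columnSpan B).starProjection (WithLp.toLp 2 (A.col j)) i

/-! Write `A = Y Wᵀ + R` with `W` the first `k` right singular vectors and `R = A - A_k`, so `Wᵀ W =
1` and `R W = 0`. Sampling columns with weight `d / s` turns these products into unbiased estimates
`G` and `M`, with mean squared Frobenius error at most `C k² / s` and `(C k / s) ‖R‖²`; coherence
enters only as a bound on the rows of `W` (`sum_sampled_mul_error_sq_le`). By Markov each estimate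
fails with probability at most 0.15. Otherwise `G` is invertible, and a combination of the chosen
columns reproduces `A_k` up to the error `M G⁻¹ Wᵀ`, of norm at most `2 ‖M‖ ≤ ε ‖R‖`
(`norm_sub_projectColumns_le_of_sampled`). -/

/-! ### Variance of uniform sampling without replacement -/

open Finset in
/-- The number of `s`-element subsets of `Fin d` containing `T`, as a sum of indicators. -/
theorem sum_indicator_subset {d s : ℕ} (T : Finset (Fin d)) (hT : T.card ≤ s) :
    ∑ I ∈ powersetCard s (univ : Finset (Fin d)), (if T ⊆ I then (1 : ℝ) else 0) =
      (((d - T.card).choose (s - T.card) : ℕ) : ℝ) := by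
  rw [sum_boole, card_filter_powersetCard_subset _ _ _ (subset_univ T) hT]
  simp

-- Expand the square: each diagonal term has weight `p₁` and each off-diagonal term the same weight
-- `q`. As the `x j` sum to zero, this collapses to `(p₁ - q) ∑ x j ^ 2`, and `q ≥ 0` is dropped.
open Finset in
theorem sum_sampled_sq_le {d s : ℕ} (hs : 0 < s) (hsd : s ≤ d) (x : Fin d → ℝ)
    (hx : ∑ j, x j = 0) :
    ∑ I ∈ powersetCard s (univ : Finset (Fin d)), (∑ j ∈ I, x j) ^ 2 ≤
      d.choose s * ((s : ℝ) / d) * ∑ j, x j ^ 2 := by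
  set p₁ : ℝ := (((d - 1).choose (s - 1) : ℕ) : ℝ) with hp₁
  obtain ⟨q, hq, hpair⟩ : ∃ q : ℝ, 0 ≤ q ∧ ∀ j l : Fin d, j ≠ l →
      ∑ I ∈ powersetCard s (univ : Finset (Fin d)),
        (if j ∈ I then (1 : ℝ) else 0) * (if l ∈ I then 1 else 0) = q := by
    -- For `s = 1` truncated subtraction would make the binomial formula give 1, whereas no sample
    -- contains a pair.
    rcases Nat.lt_or_ge s 2 with h | h
    · refine ⟨0, le_rfl, fun j l hjl => sum_eq_zero fun I hI => ?_⟩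
      have hI' : I.card ≤ 1 := by rw [mem_powersetCard_univ] at hI; omega
      rw [card_le_one] at hI'
      by_cases hj : j ∈ I <;> by_cases hl : l ∈ I <;> simp [hj, hl]
      exact hjl (hI' j hj l hl)
    · refine ⟨(((d - 2).choose (s - 2) : ℕ) : ℝ), by positivity, fun j l hjl => ?_⟩
      have := sum_indicator_subset (s := s) ({j, l} : Finset (Fin d)) (by rw [card_pair hjl]; exact h)
      rw [card_pair hjl] at this
      rw [← this]
      refine sum_congr rfl fun I _ => ?_
      by_cases hj : j ∈ I <;> by_cases hl : l ∈ I <;> simp [hj, hl, insert_subset_iff]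
  have hone (j : Fin d) : ∑ I ∈ powersetCard s (univ : Finset (Fin d)),
        (if j ∈ I then (1 : ℝ) else 0) * (if j ∈ I then 1 else 0) = p₁ := by
    have := sum_indicator_subset (s := s) ({j} : Finset (Fin d)) (by rw [card_singleton]; exact hs)
    rw [card_singleton] at this
    rw [hp₁, ← this]
    refine sum_congr rfl fun I _ => ?_
    by_cases hj : j ∈ I <;> simp [hj]
  have hp : p₁ = d.choose s * ((s : ℝ) / d) := by
    obtain ⟨s, rfl⟩ : ∃ t, s = t + 1 := ⟨s - 1, by omega⟩
    obtain ⟨d, rfl⟩ : ∃ t, d = t + 1 := ⟨d - 1, by omega⟩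
    have h := congrArg (Nat.cast (R := ℝ)) (Nat.add_one_mul_choose_eq d s)
    push_cast at h
    simp only [hp₁, Nat.add_sub_cancel]
    push_cast
    field_simp
    linarith
  have hexp : ∑ I ∈ powersetCard s (univ : Finset (Fin d)), (∑ j ∈ I, x j) ^ 2 =
      ∑ j, ∑ l, x j * x l * (∑ I ∈ powersetCard s (univ : Finset (Fin d)),
        (if j ∈ I then (1 : ℝ) else 0) * (if l ∈ I then 1 else 0)) := by
    have (I : Finset (Fin d)) : (∑ j ∈ I, x j) ^ 2 = ∑ j, ∑ l, x j * x l *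
        ((if j ∈ I then (1 : ℝ) else 0) * (if l ∈ I then 1 else 0)) := by
      have h1 : ∑ j ∈ I, x j = ∑ j, x j * (if j ∈ I then (1 : ℝ) else 0) := by simp
      rw [h1, sq, sum_mul_sum]
      exact sum_congr rfl fun j _ => sum_congr rfl fun l _ => by ring
    simp_rw [this, mul_sum]
    rw [sum_comm]
    exact sum_congr rfl fun j _ => sum_comm
  have hrow (j : Fin d) : ∑ l, x j * x l * (∑ I ∈ powersetCard s (univ : Finset (Fin d)),
        (if j ∈ I then (1 : ℝ) else 0) * (if l ∈ I then 1 else 0)) = (p₁ - q) * x j ^ 2 := by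
    have h1 (l : Fin d) : x j * x l * (∑ I ∈ powersetCard s (univ : Finset (Fin d)),
        (if j ∈ I then (1 : ℝ) else 0) * (if l ∈ I then 1 else 0)) =
        q * x j * x l + (if l = j then (p₁ - q) * x j ^ 2 else 0) := by
      by_cases h : l = j
      · subst h; rw [hone]; simp; ring
      · rw [hpair j l (Ne.symm h)]; simp [h]; ring
    simp_rw [h1, sum_add_distrib, ← mul_sum, hx]
    simp
  rw [hexp, sum_congr rfl fun j _ => hrow j, ← mul_sum, ← hp]
  have := sum_nonneg fun (j : Fin d) (_ : j ∈ univ) => sq_nonneg (x j)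
  nlinarith

open Finset in
/-- The variance bound for the estimator `(d / s) ∑_{j ∈ I} x j` of a total `∑ j, x j`
under uniform sampling without replacement. -/
theorem sum_sampling_error_sq_le {d s : ℕ} (hs : 0 < s) (hsd : s ≤ d) (x : Fin d → ℝ) :
    ∑ I : ColumnChoice d s, ((d : ℝ) / s * ∑ j ∈ I.1, x j - ∑ j, x j) ^ 2 ≤
      Nat.card (ColumnChoice d s) * ((d : ℝ) / s * ∑ j, x j ^ 2) := by
  have hd : (0 : ℝ) < d := by exact_mod_cast hs.trans_le hsd
  have hs' : (0 : ℝ) < s := by exact_mod_cast hs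
  -- Every sample has exactly `s` elements, so subtracting the mean leaves the estimation error
  -- unchanged.
  set a : ℝ := (∑ j, x j) / d with ha
  have hcenter : ∑ j, (x j - a) = 0 := by
    rw [sum_sub_distrib]; simp [ha]; field_simp; simp
  have hsq : ∑ j, (x j - a) ^ 2 ≤ ∑ j, x j ^ 2 := by
    have : ∑ j, x j ^ 2 = ∑ j, (x j - a) ^ 2 + 2 * a * ∑ j, (x j - a) + d * a ^ 2 := by
      rw [mul_sum, ← sum_add_distrib]
      have : (d : ℝ) * a ^ 2 = ∑ _j : Fin d, a ^ 2 := by simp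
      rw [this, ← sum_add_distrib]
      exact sum_congr rfl fun j _ => by ring
    rw [this, hcenter]
    have : 0 ≤ d * a ^ 2 := by positivity
    linarith
  have hcard : Nat.card (ColumnChoice d s) = d.choose s := by
    rw [Nat.card_eq_fintype_card, Fintype.card_finset_len, Fintype.card_fin]
  have hsum (f : Finset (Fin d) → ℝ) : ∑ I : ColumnChoice d s, f I.1 =
      ∑ I ∈ powersetCard s (univ : Finset (Fin d)), f I :=
    (sum_subtype _ (fun I => mem_powersetCard_univ) f).symm
  rw [hcard, hsum fun I => ((d : ℝ) / s * ∑ j ∈ I, x j - ∑ j, x j) ^ 2]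
  have hterm : ∀ I ∈ powersetCard s (univ : Finset (Fin d)),
      ((d : ℝ) / s * ∑ j ∈ I, x j - ∑ j, x j) ^ 2 =
        ((d : ℝ) / s) ^ 2 * (∑ j ∈ I, (x j - a)) ^ 2 := by
    intro I hI
    rw [mem_powersetCard_univ] at hI
    rw [sum_sub_distrib, sum_const, hI, ha, nsmul_eq_mul]
    field_simp
  rw [sum_congr rfl hterm, ← mul_sum]
  calc _ ≤ ((d : ℝ) / s) ^ 2 * (d.choose s * ((s : ℝ) / d) * ∑ j, (x j - a) ^ 2) := by
        gcongr
        exact sum_sampled_sq_le hs hsd _ hcenter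
    _ = d.choose s * ((d : ℝ) / s * ∑ j, (x j - a) ^ 2) := by field_simp
    _ ≤ _ := by gcongr

theorem Matrix.frobenius_norm_sq {m n : Type*} [Fintype m] [Fintype n] (B : Matrix m n ℝ) :
    ‖B‖ ^ 2 = ∑ i, ∑ j, B i j ^ 2 := by
  rw [Matrix.frobenius_norm_def, ← Real.sqrt_eq_rpow, Real.sq_sqrt (by positivity)]
  simp

/-- The variance bound for estimating a matrix product `B * W` from a uniform sample of columns
of `B` and corresponding rows of `W`. -/
theorem sum_sampled_mul_error_sq_le {d s : ℕ} (hs : 0 < s) (hsd : s ≤ d)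
    {m n : Type*} [Fintype m] [Fintype n] (B : Matrix m (Fin d) ℝ) (W : Matrix (Fin d) n ℝ)
    (L : ℝ) (hL : ∀ j, ∑ i, W j i ^ 2 ≤ L) :
    ∑ I : ColumnChoice d s, ‖((d : ℝ) / s) • (B * Matrix.diagonal
        (fun j => if j ∈ I.1 then (1 : ℝ) else 0) * W) - B * W‖ ^ 2 ≤
      Nat.card (ColumnChoice d s) * ((d : ℝ) / s * (L * ‖B‖ ^ 2)) := by
  have hentry (I : ColumnChoice d s) (a : m) (b : n) :
      (((d : ℝ) / s) • (B * Matrix.diagonal (fun j => if j ∈ I.1 then (1 : ℝ) else 0) * W)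
        - B * W) a b = (d : ℝ) / s * ∑ j ∈ I.1, B a j * W j b - ∑ j, B a j * W j b := by
    rw [Matrix.sub_apply, Matrix.smul_apply, Matrix.mul_apply, Matrix.mul_apply, smul_eq_mul]
    simp_rw [Matrix.mul_diagonal]
    simp
  simp_rw [Matrix.frobenius_norm_sq, hentry]
  rw [Finset.sum_comm]
  simp_rw [Finset.sum_comm (s := (Finset.univ : Finset (ColumnChoice d s)))]
  calc _ ≤ ∑ a, ∑ b, Nat.card (ColumnChoice d s) *
          ((d : ℝ) / s * ∑ j, (B a j * W j b) ^ 2) :=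
        Finset.sum_le_sum fun a _ => Finset.sum_le_sum fun b _ =>
          sum_sampling_error_sq_le hs hsd _
    _ = Nat.card (ColumnChoice d s) * ((d : ℝ) / s * ∑ a, ∑ j, B a j ^ 2 * ∑ b, W j b ^ 2) := by
        simp_rw [← Finset.mul_sum, mul_pow, Finset.mul_sum (Finset.univ : Finset n)]
        congr 2
        exact Finset.sum_congr rfl fun a _ => Finset.sum_comm
    _ ≤ Nat.card (ColumnChoice d s) * ((d : ℝ) / s * ∑ a, ∑ j, B a j ^ 2 * L) := by
        gcongr with a _ j _
        exact hL j
    _ = _ := by simp_rw [← Finset.sum_mul, mul_comm L]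

/-- Markov's inequality for a uniform random choice. -/
theorem ncard_lt_le_of_sum_le {α : Type*} [Fintype α] (f : α → ℝ) (hf : ∀ x, 0 ≤ f x)
    {t p : ℝ} (ht : 0 ≤ t) (hp : 0 ≤ p) (h : ∑ x, f x ≤ Nat.card α * (p * t)) :
    ({x | t < f x}.ncard : ℝ) ≤ p * Nat.card α := by
  classical
  have hfil : {x | t < f x} = ((Finset.univ.filter fun x => t < f x : Finset α) : Set α) := by
    ext; simp
  rw [hfil, Set.ncard_coe_finset]
  have hle : ∑ x with t < f x, f x ≤ ∑ x, f x :=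
    Finset.sum_le_sum_of_subset_of_nonneg (Finset.subset_univ _) fun x _ _ => hf x
  -- The threshold is zero when the residual `R` vanishes; then `f` is identically zero.
  rcases ht.eq_or_lt with rfl | ht
  · have h0 : Finset.univ.filter (fun x => 0 < f x) = ∅ := by
      refine Finset.filter_eq_empty_iff.2 fun x _ hx => ?_
      have := Finset.single_le_sum (fun y _ => hf y) (Finset.mem_univ x)
      simp only [mul_zero] at h
      linarith
    rw [h0]
    simp only [Finset.card_empty, Nat.cast_zero]
    positivity
  · have : ((Finset.univ.filter fun x => t < f x).card : ℝ) * t ≤ ∑ x with t < f x, f x := by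
      rw [← nsmul_eq_mul]
      exact Finset.card_nsmul_le_sum _ _ _ fun x hx => (Finset.mem_filter.1 hx).2.le
    refine le_of_mul_le_mul_right ?_ ht
    linarith

/-! ### Deterministic error bound for a good sample -/

/-- Projecting onto the column span of `B` is a best approximation among the products `B * X`. -/
theorem norm_sub_projectColumns_le {m d s : ℕ} (B : Matrix (Fin m) (Fin s) ℝ)
    (A : Matrix (Fin m) (Fin d) ℝ) (X : Matrix (Fin s) (Fin d) ℝ) :
    ‖A - projectColumns B A‖ ≤ ‖A - B * X‖ := by
  refine le_of_sq_le_sq ?_ (norm_nonneg _)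
  rw [Matrix.frobenius_norm_sq, Matrix.frobenius_norm_sq, Finset.sum_comm,
    Finset.sum_comm (γ := Fin m)]
  refine Finset.sum_le_sum fun j _ => ?_
  set a : EuclideanSpace ℝ (Fin m) := WithLp.toLp 2 (A.col j) with ha
  have hmem : WithLp.toLp 2 ((B * X).col j) ∈ columnSpan B := by
    have : WithLp.toLp 2 ((B * X).col j) = ∑ l, X l j • WithLp.toLp 2 (B.col l) := by
      ext i
      simp [Matrix.mul_apply, mul_comm]
    rw [this]
    exact Submodule.sum_mem _ fun l _ =>
      Submodule.smul_mem _ _ (Submodule.subset_span (Set.mem_range_self l))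
  have h : ‖a - (columnSpan B).starProjection a‖ ≤ ‖a - WithLp.toLp 2 ((B * X).col j)‖ := by
    rw [Submodule.starProjection_minimal]
    exact ciInf_le ⟨0, by rintro _ ⟨x, rfl⟩; positivity⟩
      (⟨_, hmem⟩ : columnSpan B)
  have h2 := pow_le_pow_left₀ (norm_nonneg _) h 2
  rw [EuclideanSpace.norm_sq_eq, EuclideanSpace.norm_sq_eq] at h2
  simpa [projectColumns, ha] using h2

theorem Matrix.frobenius_norm_mul_transpose_of_orthonormal {m d n : Type*} [Fintype m] [Fintype d]
    [Fintype n] [DecidableEq n] (Z : Matrix m n ℝ) (W : Matrix d n ℝ) (hW : W.transpose * W = 1) :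
    ‖Z * W.transpose‖ = ‖Z‖ := by
  refine (sq_eq_sq₀ (norm_nonneg _) (norm_nonneg _)).1 ?_
  rw [Matrix.frobenius_norm_sq, Matrix.frobenius_norm_sq]
  have h : Z * W.transpose * (Z * W.transpose).transpose = Z * Z.transpose := by
    rw [Matrix.transpose_mul, Matrix.transpose_transpose, Matrix.mul_assoc,
      ← Matrix.mul_assoc W.transpose, hW, Matrix.one_mul]
  have h' := congrArg Matrix.trace h
  simp only [Matrix.trace, Matrix.diag_apply, Matrix.mul_apply, Matrix.transpose_apply] at h'
  simpa only [Matrix.mul_apply, Matrix.transpose_apply, sq] using h'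

theorem selectionMatrix_transpose_mul_self {d s : ℕ} (I : ColumnChoice d s) :
    (selectionMatrix I).transpose * selectionMatrix I =
      Matrix.diagonal fun j => if j ∈ I.1 then (1 : ℝ) else 0 := by
  ext a b
  rw [Matrix.mul_apply]
  simp only [Matrix.transpose_apply, selectionMatrix, Matrix.of_apply, Matrix.diagonal_apply]
  by_cases hab : a = b
  · subst hab
    by_cases ha : a ∈ I.1
    · obtain ⟨j, rfl⟩ : a ∈ Set.range (I.1.orderEmbOfFin I.2) := by simpa using ha
      simp
    · have : ∀ j, a ≠ I.1.orderEmbOfFin I.2 j := by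
        rintro j rfl
        exact ha (Finset.orderEmbOfFin_mem _ _ _)
      simp [ha, this]
  · rw [if_neg hab]
    refine Finset.sum_eq_zero fun j _ => ?_
    by_cases h : a = I.1.orderEmbOfFin I.2 j
    · have : b ≠ I.1.orderEmbOfFin I.2 j := fun h' => hab (h.trans h'.symm)
      simp [this]
    · simp [h]

/-- If the sampled Gram matrix of `W` is close to the identity and the sampled product of the
residual `R` with `W` is small, the chosen columns of `Y * Wᵀ + R` span a near-optimal space. -/
theorem norm_sub_projectColumns_le_of_sampled {m d s : ℕ} {n : Type*} [Fintype n] [DecidableEq n]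
    (I : ColumnChoice d s) (A R : Matrix (Fin m) (Fin d) ℝ) (Y : Matrix (Fin m) n ℝ)
    (W : Matrix (Fin d) n ℝ) (hA : A = Y * W.transpose + R) (hW : W.transpose * W = 1) (t ε : ℝ)
    (hG : ‖t • (W.transpose * Matrix.diagonal (fun j => if j ∈ I.1 then (1 : ℝ) else 0) * W)
      - 1‖ ≤ 1 / 2)
    (hM : ‖t • (R * Matrix.diagonal (fun j => if j ∈ I.1 then (1 : ℝ) else 0) * W)‖
      ≤ ε / 2 * ‖R‖) :
    ‖A - projectColumns (A * (selectionMatrix I).transpose) A‖ ≤ (1 + ε) * ‖R‖ := by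
  rw [← selectionMatrix_transpose_mul_self] at hG hM
  set S := selectionMatrix I
  set G := t • (W.transpose * (S.transpose * S) * W) with hGdef
  set M := t • (R * (S.transpose * S) * W) with hMdef
  obtain ⟨H, hH⟩ : ∃ H, G * H = 1 := by
    have h : IsUnit (1 - (1 - G)) := isUnit_one_sub_of_norm_lt_one (by
      rw [norm_sub_rev]; linarith)
    rw [sub_sub_cancel] at h
    exact h.exists_right_inv
  have hH' : H * G = 1 := mul_eq_one_comm.1 hH
  have hZ : ‖M * H‖ ≤ ε * ‖R‖ := by
    -- Absorbing half of `‖M * H‖` on the left gives `‖M * H‖ ≤ 2 ‖M‖` with no bound on `‖H‖`, whose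
    -- Frobenius norm would depend on `k`.
    have h1 : M * H = M - M * H * (G - 1) := by
      rw [Matrix.mul_sub, Matrix.mul_one, Matrix.mul_assoc M H G, hH', Matrix.mul_one]
      abel
    have h2 : ‖M * H‖ ≤ ‖M‖ + ‖M * H‖ * ‖G - 1‖ := by
      calc ‖M * H‖ = ‖M - M * H * (G - 1)‖ := by rw [← h1]
        _ ≤ ‖M‖ + ‖M * H * (G - 1)‖ := norm_sub_le _ _
        _ ≤ _ := by gcongr; exact Matrix.frobenius_norm_mul _ _
    have h3 := mul_le_mul_of_nonneg_left hG (norm_nonneg (M * H))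
    linarith
  have hX : A - A * S.transpose * (t • (S * W * H * W.transpose)) =
      R - M * H * W.transpose := by
    have h1 : A * S.transpose * (t • (S * W * H * W.transpose)) =
        Y * (G * H) * W.transpose + M * H * W.transpose := by
      rw [hA, hGdef, hMdef]
      simp only [Matrix.add_mul, Matrix.mul_smul, Matrix.smul_mul, Matrix.mul_assoc, smul_add]
    rw [h1, hH, Matrix.mul_one, hA]
    abel
  calc _ ≤ ‖A - A * S.transpose * (t • (S * W * H * W.transpose))‖ :=
        norm_sub_projectColumns_le _ _ _
    _ ≤ ‖R‖ + ‖M * H * W.transpose‖ := by rw [hX]; exact norm_sub_le _ _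
    _ ≤ (1 + ε) * ‖R‖ := by
        rw [Matrix.frobenius_norm_mul_transpose_of_orthonormal _ _ hW]
        linarith

/-! ### Factors of the truncated decomposition -/

namespace MatrixSVD

variable {m d : ℕ} {A : Matrix (Fin m) (Fin d) ℝ}

/-- The matrix whose columns are the first `k` right singular vectors. -/
def rightFactor (D : MatrixSVD A) (k : ℕ) : Matrix (Fin d) {i : Fin D.r // i.val < k} ℝ :=
  Matrix.of fun j i => D.v i.1 j

/-- The matrix whose columns are the first `k` left singular vectors, scaled by the singular
values. -/
def leftFactor (D : MatrixSVD A) (k : ℕ) : Matrix (Fin m) {i : Fin D.r // i.val < k} ℝ :=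
  Matrix.of fun a i => D.σ i.1 * D.u i.1 a

theorem sum_v_mul_v (D : MatrixSVD A) (i i' : Fin D.r) :
    ∑ j, D.v i j * D.v i' j = if i = i' then 1 else 0 := by
  have := (orthonormal_iff_ite.1 D.v_orthonormal) i' i
  simpa [PiLp.inner_apply, eq_comm] using this

theorem rightFactor_transpose_mul_self (D : MatrixSVD A) (k : ℕ) :
    (D.rightFactor k).transpose * D.rightFactor k = 1 := by
  ext i i'
  simp [Matrix.mul_apply, rightFactor, sum_v_mul_v, Matrix.one_apply, Subtype.ext_iff]

theorem trunc_eq_mul (D : MatrixSVD A) (k : ℕ) :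
    D.trunc k = D.leftFactor k * (D.rightFactor k).transpose := by
  ext a j
  simp only [trunc, Matrix.sum_apply, Matrix.smul_apply, Matrix.vecMulVec_apply, smul_eq_mul,
    Matrix.mul_apply, leftFactor, rightFactor, Matrix.of_apply, Matrix.transpose_apply]
  rw [Finset.sum_subtype (p := fun i : Fin D.r => i.val < k) _ (by simp)]
  exact Finset.sum_congr rfl fun i _ => by ring

/-- The residual involves only the later right singular vectors, which are orthogonal to the first
`k`. -/
theorem sub_trunc_mul_rightFactor (D : MatrixSVD A) (k : ℕ) :
    (A - D.trunc k) * D.rightFactor k = 0 := by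
  have hR : A - D.trunc k = ∑ i with ¬ i.val < k,
      D.σ i • Matrix.vecMulVec (D.u i).ofLp (D.v i).ofLp := by
    rw [sub_eq_iff_eq_add', trunc, Finset.sum_filter_add_sum_filter_not]
    exact D.eq_sum
  rw [hR, Matrix.sum_mul]
  refine Finset.sum_eq_zero fun i hi => ?_
  ext a b
  have hne : i ≠ b.1 := by
    rintro rfl
    exact (Finset.mem_filter.1 hi).2 b.2
  have h := D.sum_v_mul_v i b.1
  rw [if_neg hne] at h
  simp [Matrix.mul_apply, Matrix.vecMulVec_apply, rightFactor, mul_assoc, ← Finset.mul_sum, h]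

theorem sum_rightFactor_sq_le (D : MatrixSVD A) (k : ℕ) (j : Fin d) :
    ∑ i, D.rightFactor k j i ^ 2 ≤ D.coherence k := by
  have h : ∑ i, D.rightFactor k j i ^ 2 = D.leverage k j := by
    rw [leverage, Finset.sum_subtype (p := fun i : Fin D.r => i.val < k) _ (by simp)]
    rfl
  rw [h]
  exact le_ciSup (Set.finite_range _).bddAbove j

theorem norm_rightFactor_transpose_sq_le (D : MatrixSVD A) (k : ℕ) :
    ‖(D.rightFactor k).transpose‖ ^ 2 ≤ k := by
  rw [Matrix.frobenius_norm_sq]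
  have (i : {i : Fin D.r // i.val < k}) :
      ∑ j, (D.rightFactor k).transpose i j ^ 2 = 1 := by
    simpa [sq, rightFactor] using D.sum_v_mul_v i.1 i.1
  simp_rw [this]
  have hinj := Fintype.card_le_of_injective
    (fun i : {i : Fin D.r // i.val < k} => (⟨i.1.val, i.2⟩ : Fin k))
    (fun i i' h => by simpa [Subtype.ext_iff, Fin.ext_iff] using h)
  simpa using hinj

end MatrixSVD

/-! ### Union bound and conclusion -/

theorem uniformProb_ge_of_ncard_compl_le {d s : ℕ} (hsd : s ≤ d) (E : Set (ColumnChoice d s))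
    {p : ℝ} (h : (Eᶜ.ncard : ℝ) ≤ p * Nat.card (ColumnChoice d s)) : 1 - p ≤ uniformProb E := by
  have hpos : 0 < (Nat.card (ColumnChoice d s) : ℝ) := by
    rw [Nat.card_eq_fintype_card, Fintype.card_finset_len, Fintype.card_fin]
    exact_mod_cast Nat.choose_pos hsd
  have hc := congrArg (Nat.cast (R := ℝ)) (Set.ncard_add_ncard_compl E)
  push_cast at hc
  rw [uniformProb, le_div_iff₀ hpos]
  linarith

theorem theorem1 :
    ∃ c : ℝ, 0 < c ∧
      ∀ (m d k s : ℕ) (A : Matrix (Fin m) (Fin d) ℝ) (D : MatrixSVD A) (C ε : ℝ),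
        0 < C → 0 < ε → ε ≤ 1 →
        D.coherence k ≤ C * ((k : ℝ) / (d : ℝ)) →
        c * C * ((k : ℝ) ^ 2 / ε ^ 2) ≤ (s : ℝ) → s ≤ d →
        (0.7 : ℝ) ≤ uniformProb
          {I : ColumnChoice d s |
            ‖A - projectColumns (A * (selectionMatrix I).transpose) A‖ ≤
              (1 + ε) * ‖A - D.trunc k‖} := by
  -- Both Markov bounds need a constant of at least `4 / 0.15 = 80 / 3`.
  refine ⟨27, by norm_num, fun m d k s A D C ε hC hε hε1 hcoh hs hsd => ?_⟩
  -- For `k = 0` the sample may be empty, but `A_0 = 0` and every choice of columns succeeds.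
  rcases Nat.eq_zero_or_pos k with rfl | hk
  · refine le_trans (by norm_num) (uniformProb_ge_of_ncard_compl_le hsd _ (p := 0) ?_)
    rw [show {I : ColumnChoice d s |
        ‖A - projectColumns (A * (selectionMatrix I).transpose) A‖ ≤
          (1 + ε) * ‖A - D.trunc 0‖} = Set.univ from ?_]
    · simp
    · refine Set.eq_univ_of_forall fun I => ?_
      have h := norm_sub_projectColumns_le (A * (selectionMatrix I).transpose) A 0
      have h0 : D.trunc 0 = 0 := by simp [MatrixSVD.trunc]
      rw [Matrix.mul_zero, sub_zero] at h
      rw [Set.mem_ofPred_eq, h0, sub_zero]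
      nlinarith [norm_nonneg A]
  have hk' : (1 : ℝ) ≤ k := by exact_mod_cast hk
  have hs0 : (0 : ℝ) < s := lt_of_lt_of_le (by positivity) hs
  have hsn : 0 < s := by exact_mod_cast hs0
  have hd0 : (0 : ℝ) < d := by exact_mod_cast hsn.trans_le hsd
  have hs' : 27 * C * (k : ℝ) ^ 2 ≤ s * ε ^ 2 := by
    rwa [← mul_div_assoc, div_le_iff₀ (by positivity)] at hs
  set R := A - D.trunc k with hR
  set W := D.rightFactor k
  have hL (j : Fin d) : ∑ i, W j i ^ 2 ≤ C * ((k : ℝ) / d) :=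
    (D.sum_rightFactor_sq_le k j).trans hcoh
  have hscale (x : ℝ) : (d : ℝ) / s * (C * ((k : ℝ) / d) * x) = C * k / s * x := by
    field_simp
  have hbad₁ := ncard_lt_le_of_sum_le
    (fun I : ColumnChoice d s => ‖((d : ℝ) / s) • (W.transpose * Matrix.diagonal
      (fun j => if j ∈ I.1 then (1 : ℝ) else 0) * W) - W.transpose * W‖ ^ 2)
    (fun I => sq_nonneg _) (t := 1 / 4) (p := 0.15) (by norm_num) (by norm_num) (by
      refine (sum_sampled_mul_error_sq_le hsn hsd W.transpose W _ hL).trans ?_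
      refine mul_le_mul_of_nonneg_left ?_ (Nat.cast_nonneg _)
      rw [hscale]
      calc C * k / s * ‖W.transpose‖ ^ 2 ≤ C * k / s * k := by
            gcongr; exact D.norm_rightFactor_transpose_sq_le k
        _ ≤ 0.15 * (1 / 4) := by
            rw [div_mul_eq_mul_div, div_le_iff₀ hs0]
            have : ε ^ 2 ≤ 1 := pow_le_one₀ hε.le hε1
            nlinarith)
  have hbad₂ := ncard_lt_le_of_sum_le
    (fun I : ColumnChoice d s => ‖((d : ℝ) / s) • (R * Matrix.diagonal
      (fun j => if j ∈ I.1 then (1 : ℝ) else 0) * W) - R * W‖ ^ 2)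
    (fun I => sq_nonneg _) (t := (ε / 2 * ‖R‖) ^ 2) (p := 0.15) (by positivity) (by norm_num) (by
      refine (sum_sampled_mul_error_sq_le hsn hsd R W _ hL).trans ?_
      refine mul_le_mul_of_nonneg_left ?_ (Nat.cast_nonneg _)
      rw [hscale, mul_pow, ← mul_assoc]
      gcongr
      rw [div_le_iff₀ hs0]
      have : C * k ≤ C * k ^ 2 := by gcongr; nlinarith
      nlinarith)
  refine le_trans (show (0.7 : ℝ) ≤ 1 - (0.15 + 0.15) by norm_num)
    (uniformProb_ge_of_ncard_compl_le hsd _ ?_)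
  rw [add_mul (0.15 : ℝ)]
  refine le_trans ?_ (add_le_add hbad₁ hbad₂)
  rw [← Nat.cast_add]
  refine le_trans ?_ (Nat.cast_le.2 (Set.ncard_union_le _ _))
  refine Nat.cast_le.2 (Set.ncard_le_ncard ?_ (Set.toFinite _))
  intro I hI
  by_contra hgood
  simp only [Set.mem_union, Set.mem_ofPred_eq, not_or, not_lt] at hgood
  obtain ⟨h₁, h₂⟩ := hgood
  rw [D.rightFactor_transpose_mul_self] at h₁
  rw [D.sub_trunc_mul_rightFactor, sub_zero] at h₂
  refine hI (norm_sub_projectColumns_le_of_sampled I A R (D.leftFactor k) W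
    (by rw [hR, D.trunc_eq_mul]; abel) (D.rightFactor_transpose_mul_self k) ((d : ℝ) / s) ε ?_ ?_)
  · exact le_of_sq_le_sq (h₁.trans (by norm_num)) (by norm_num)
  · exact le_of_sq_le_sq h₂ (by positivity)
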